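/- For finite-dimensional C*-algebras $F_1,F_2$ and (not necessarily unital) *-homomorphisms $\varphi_0,\varphi_1:F_1\to F_2$ put $$A(F_1,F_2,\varphi_0,\varphi_1)=\{(f,g)\in C([0,1],F_2)\oplus F_1:\ f(0)=\varphi_0(g),\ f(1)=\varphi_1(g)\}.$$ For a C*-algebra $C$ let $T(C)$ be the set of its tracial states (positive linear functionals $\tau$ with $\|\tau\|=1$ and $\tau(xy)=\tau(yx)$). Let $\mathcal C_0$ be the class of all non-zero C*-algebras $C$ isomorphic to some $A(F_1,F_2,\varphi_0,\varphi_1)$ such that $K_1(C)=\{0\}$, $K_0(C)_+=\{0\}$ (where $K_0(C)_+\subset K_0(C)$ is the set of classes of projections in matrix algebras over $C$), and $0$ is not in the weak* closure of $T(C)$ in $C^*$. Let $\mathcal C_0'$ be the class of all C*-algebras isomorphic to a full hereditary sub-C*-algebra of an algebra in $\mathcal C_0$. For $0<\varepsilon<1$ let $f_\varepsilon:[0,\infty)\to[0,1]$ be $0$ on $[0,\varepsilon/2]$, $1$ on $[\varepsilon,\infty)$ and linear on $[\varepsilon/2,\varepsilon]$. For positive elements $a,b$ of a C*-algebra $A$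 write $a\lesssim b$ if there are $x_n\in A$ with $x_n^*bx_n\to a$ in norm. An element $a\in A_+$ is strictly positive if $\overline{aAa}=A$. A map $\varphi$ is $\mathcal F$-$\varepsilon$-multiplicative if $\|\varphi(xy)-\varphi(x)\varphi(y)\|<\varepsilon$ for all $x,y\in\mathcal F$. A non-zero simple C*-algebra $A$ (no non-trivial closed two-sided ideals) is in the class $\mathcal D$ if there are a strictly positive element $a\in A$ with $\|a\|=1$ and a number $0<\mathfrak f_a<1$ such that for every $\varepsilon>0$, every finite subset $\mathcal F\subset A$ and every $b\in A_+\setminus\{0\}$ there are a sub-C*-algebra $D\subset A$ with $D\in\mathcal C_0'$ and $\mathcal F$-$\varepsilon$-multiplicative completely positive contractive maps $\varphi:A\to A$ and $\psi:A\to D$ such that - $\varphi(A)D=\{0\}$; - $\|x-(\varphi(x)+\psi(x))\|<\varepsilon$ for all $x\in\mathcal F\cup\{a\}$; - $\varphi(a)\lesssim b$; - $t(f_{1/4}(\psi(a)))\ge\mathfrak f_a$ for all $t\in T(D)$. **Proposition.** Every C*-algebra $A$ in $\mathcal D$ is stably projectionless: for every $n$, the matrix algebra $M_n(A)$ contains no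 non-zero projection. -/

import Mathlib

open scoped CStarAlgebra ComplexOrder Topology unitInterval

noncomputable section

namespace GenTracialRank

universe u v

/-! ### K-theory

Matrices over a C*-algebra `B` are taken with the conjugate-transpose involution and the
entrywise topology, which is the topology of the C*-norm of `M_n(B)`. -/

section KTheory

/-- The block-diagonal sum `diag(x, y)` of two square matrices. -/
def dsum {B : Type u} [Zero B] {n m : ℕ} (x : Matrix (Fin n) (Fin n) B)
    (y : Matrix (Fin m) (Fin m) B) : Matrix (Fin (n + m)) (Fin (n + m)) B :=
  (Matrix.fromBlocks x 0 0 y).submatrix finSumFinEquiv.symm finSumFinEquiv.symm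

/-- Projections in the matrix algebras `M_n(B)`, `n = 0, 1, 2, …`. -/
abbrev MatProj (B : Type u) [NonUnitalRing B] [StarRing B] : Type u :=
  Σ n : ℕ, {p : Matrix (Fin n) (Fin n) B // IsStarProjection p}

/-- Unitaries in the matrix algebras `M_n(B)`, `n = 0, 1, 2, …`. -/
abbrev MatUnitary (B : Type u) [Ring B] [StarRing B] : Type u :=
  Σ n : ℕ, unitary (Matrix (Fin n) (Fin n) B)

theorem dsum_mul_dsum {B : Type u} [NonUnitalRing B] {n m : ℕ} (x x' : Matrix (Fin n) (Fin n) B)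
    (y y' : Matrix (Fin m) (Fin m) B) :
    dsum x y * dsum x' y' = dsum (x * x') (y * y') := by
  simp [dsum, Matrix.submatrix_mul_equiv, Matrix.fromBlocks_multiply]

theorem star_dsum {B : Type u} [NonUnitalRing B] [StarRing B] {n m : ℕ}
    (x : Matrix (Fin n) (Fin n) B) (y : Matrix (Fin m) (Fin m) B) :
    star (dsum x y) = dsum (star x) (star y) := by
  simp [dsum, Matrix.star_eq_conjTranspose, Matrix.fromBlocks_conjTranspose]

theorem dsum_one_one {B : Type u} [Ring B] {n m : ℕ} :
    dsum (1 : Matrix (Fin n) (Fin n) B) (1 : Matrix (Fin m) (Fin m) B) = 1 := by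
  simp [dsum, Matrix.fromBlocks_one]

/-- The direct sum `p ⊕ q` of matrix projections. -/
def MatProj.sum {B : Type u} [NonUnitalRing B] [StarRing B] (p q : MatProj B) : MatProj B :=
  ⟨p.1 + q.1, dsum p.2.1 q.2.1, by
    have h1 : p.2.1 * p.2.1 = p.2.1 := p.2.2.isIdempotentElem
    have h2 : q.2.1 * q.2.1 = q.2.1 := q.2.2.isIdempotentElem
    have h3 : star p.2.1 = p.2.1 := p.2.2.isSelfAdjoint
    have h4 : star q.2.1 = q.2.1 := q.2.2.isSelfAdjoint
    refine ⟨?_, ?_⟩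
    · change dsum p.2.1 q.2.1 * dsum p.2.1 q.2.1 = dsum p.2.1 q.2.1
      rw [dsum_mul_dsum, h1, h2]
    · change star (dsum p.2.1 q.2.1) = dsum p.2.1 q.2.1
      rw [star_dsum, h3, h4]⟩

/-- The direct sum `u ⊕ v` of matrix unitaries. -/
def MatUnitary.sum {B : Type u} [Ring B] [StarRing B] (u v : MatUnitary B) : MatUnitary B :=
  ⟨u.1 + v.1, dsum u.2.1 v.2.1, by
    have h1 := Unitary.mem_iff.1 u.2.2
    have h2 := Unitary.mem_iff.1 v.2.2
    rw [Unitary.mem_iff, star_dsum, dsum_mul_dsum, dsum_mul_dsum, h1.1, h1.2, h2.1, h2.2,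
      dsum_one_one]
    exact ⟨rfl, rfl⟩⟩

/-- Murray–von Neumann equivalence of projections in (possibly different) matrix algebras:
`p = v*v` and `q = vv*` for a rectangular matrix `v`. -/
def MvN {B : Type u} [NonUnitalRing B] [StarRing B] (p q : MatProj B) : Prop :=
  ∃ v : Matrix (Fin q.1) (Fin p.1) B,
    v.conjTranspose * v = p.2.1 ∧ v * v.conjTranspose = q.2.1

/-- The relations of the Grothendieck group of Murray–von Neumann classes of projections. -/
def k0Relations (B : Type u) [Ring B] [StarRing B] : Set (FreeAbelianGroup (MatProj B)) :=
  {x | ∃ p q : MatProj B, MvN p q ∧ x = FreeAbelianGroup.of p - FreeAbelianGroup.of q} ∪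
  {x | ∃ p q : MatProj B,
    x = FreeAbelianGroup.of (p.sum q) - (FreeAbelianGroup.of p + FreeAbelianGroup.of q)}

/-- `K₀(B)` of a unital C*-algebra `B`: the Grothendieck group of the semigroup of
Murray–von Neumann classes of projections in matrices over `B`, with sum `[p] + [q] = [p ⊕ q]`. -/
abbrev K0Unital (B : Type u) [Ring B] [StarRing B] : Type u :=
  FreeAbelianGroup (MatProj B) ⧸ AddSubgroup.closure (k0Relations B)

/-- The class `[p]` in `K₀(B)`, `B` unital. -/
def K0Unital.mk {B : Type u} [Ring B] [StarRing B] (p : MatProj B) : K0Unital B :=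
  QuotientAddGroup.mk (FreeAbelianGroup.of p)

theorem isStarProjection_map {B : Type u} {C : Type v} [NonUnitalRing B] [StarRing B]
    [NonUnitalRing C] [StarRing C] (f : B →ₙ+* C) (hf : ∀ b, f (star b) = star (f b)) {n : ℕ}
    {p : Matrix (Fin n) (Fin n) B} (hp : IsStarProjection p) : IsStarProjection (p.map f) := by
  refine ⟨?_, ?_⟩
  · have h : p * p = p := hp.isIdempotentElem
    change p.map f * p.map f = p.map f
    rw [← Matrix.map_mul, h]
  · have h : star p = p := hp.isSelfAdjoint
    change star (p.map f) = p.map f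
    ext i j
    have h2 := congrFun (congrFun h i) j
    simp only [Matrix.star_apply, Matrix.map_apply] at h2 ⊢
    rw [← hf, h2]

/-- Entrywise image of a matrix projection under a *-homomorphism. -/
def MatProj.map {B : Type u} {C : Type v} [NonUnitalRing B] [StarRing B]
    [NonUnitalRing C] [StarRing C] (f : B →ₙ+* C) (hf : ∀ b, f (star b) = star (f b))
    (p : MatProj B) : MatProj C :=
  ⟨p.1, p.2.1.map f, isStarProjection_map f hf p.2.2⟩

theorem k0_map_relations {B : Type u} {C : Type v} [Ring B] [StarRing B]
    [Ring C] [StarRing C] (f : B →ₙ+* C) (hf : ∀ b, f (star b) = star (f b)) :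
    AddSubgroup.closure (k0Relations B) ≤ (AddSubgroup.closure (k0Relations C)).comap
      (FreeAbelianGroup.map (MatProj.map f hf)) := by
  rw [AddSubgroup.closure_le]
  rintro x (⟨p, q, ⟨v, h1, h2⟩, rfl⟩ | ⟨p, q, rfl⟩)
  · refine AddSubgroup.subset_closure (Or.inl ⟨p.map f hf, q.map f hf, ⟨v.map f, ?_, ?_⟩, ?_⟩)
    · change _ = p.2.1.map f
      rw [← h1, Matrix.map_mul, Matrix.conjTranspose_map f (fun b => hf b)]
      rfl
    · change _ = q.2.1.map f
      rw [← h2, Matrix.map_mul, Matrix.conjTranspose_map f (fun b => hf b)]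
      rfl
    · simp [FreeAbelianGroup.map_of_apply]
  · have h : (p.sum q).map f hf = (p.map f hf).sum (q.map f hf) := by
      refine Sigma.ext rfl (heq_of_eq (Subtype.ext ?_))
      change ((Matrix.fromBlocks p.2.1 0 0 q.2.1).map f).submatrix _ _ =
        (Matrix.fromBlocks (p.2.1.map f) 0 0 (q.2.1.map f)).submatrix _ _
      rw [Matrix.fromBlocks_map, Matrix.map_zero _ (map_zero f), Matrix.map_zero _ (map_zero f)]
      rfl
    refine AddSubgroup.subset_closure (Or.inr ⟨p.map f hf, q.map f hf, ?_⟩)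
    simp [FreeAbelianGroup.map_of_apply, h]

/-- The homomorphism `K₀(B) → K₀(C)` induced by a *-homomorphism. -/
def K0Unital.map {B : Type u} {C : Type v} [Ring B] [StarRing B]
    [Ring C] [StarRing C] (f : B →ₙ+* C) (hf : ∀ b, f (star b) = star (f b)) :
    K0Unital B →+ K0Unital C :=
  QuotientAddGroup.map _ _ (FreeAbelianGroup.map (MatProj.map f hf)) (k0_map_relations f hf)

variable (A : Type u) [NonUnitalCStarAlgebra A]

/-- `K₀(A)` of a C*-algebra: the kernel of `K₀(Ã) → K₀(ℂ)`, where `Ã` is the unitization. -/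
def K0 : AddSubgroup (K0Unital (Unitization ℂ A)) :=
  (K0Unital.map ((Unitization.fstHom ℂ A : Unitization ℂ A →+* ℂ) : Unitization ℂ A →ₙ+* ℂ)
    (fun x => Unitization.fst_star x)).ker

/-- The positive cone `K₀(A)₊`: the classes of the projections in the matrix algebras over `A`. -/
def K0Pos : Set (K0 A) :=
  {x | ∃ p : MatProj A, (x : K0Unital (Unitization ℂ A)) =
    K0Unital.mk (p.map (Unitization.inrNonUnitalAlgHom ℂ A : A →ₙ+* Unitization ℂ A)
      (fun a => Unitization.inr_star a))}

/-- The relations of `K₁`: homotopic unitaries of the same size agree, `[u ⊕ v] = [u] + [v]`,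
and `[1] = 0`. -/
def k1Relations (B : Type u) [CStarAlgebra B] : Set (FreeAbelianGroup (MatUnitary B)) :=
  {x | ∃ (n : ℕ) (u v : unitary (Matrix (Fin n) (Fin n) B)),
    JoinedIn (unitary (Matrix (Fin n) (Fin n) B) : Set (Matrix (Fin n) (Fin n) B)) u v ∧
    x = FreeAbelianGroup.of (⟨n, u⟩ : MatUnitary B) - FreeAbelianGroup.of (⟨n, v⟩ : MatUnitary B)} ∪
  {x | ∃ u v : MatUnitary B,
    x = FreeAbelianGroup.of (u.sum v) - (FreeAbelianGroup.of u + FreeAbelianGroup.of v)} ∪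
  {x | ∃ n : ℕ, x = FreeAbelianGroup.of (⟨n, 1⟩ : MatUnitary B)}

/-- `K₁(A) = K₁(Ã)`: stable homotopy classes of unitaries in matrices over the unitization,
with `[u] + [v] = [u ⊕ v]`. -/
abbrev K1 : Type u :=
  FreeAbelianGroup (MatUnitary (Unitization ℂ A)) ⧸
    AddSubgroup.closure (k1Relations (Unitization ℂ A))

end KTheory

/-! ### Traces, ideals, hereditary subalgebras -/

section Basic

variable (A : Type u) [NonUnitalCStarAlgebra A]

/-- The tracial states of `A`, inside the dual of `A` with its weak* topology. -/
def tracialStates : Set (WeakDual ℂ A) :=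
  {τ | (∀ a : A, 0 ≤ τ (star a * a)) ∧ (∀ a b : A, τ (a * b) = τ (b * a)) ∧
    ‖WeakDual.toStrongDual τ‖ = 1}

/-- `A` is non-zero and has no non-trivial closed two-sided ideals. -/
def IsSimpleCStar : Prop :=
  Nontrivial A ∧ ∀ J : TwoSidedIdeal A, IsClosed (J : Set A) → J = ⊥ ∨ J = ⊤

variable {A}

/-- Hereditary *-subalgebras: if `0 ≤ x*x ≤ h` and `h ∈ H`, then `x*x ∈ H`. -/
def IsHereditary (H : NonUnitalStarSubalgebra ℂ A) : Prop :=
  ∀ x y h : A, h ∈ H → h - star x * x = star y * y → star x * x ∈ H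

/-- Full subalgebras: those not contained in a proper closed two-sided ideal. -/
def IsFull (H : NonUnitalStarSubalgebra ℂ A) : Prop :=
  ∀ J : TwoSidedIdeal A, IsClosed (J : Set A) → (H : Set A) ⊆ (J : Set A) → J = ⊤

/-- Cuntz subequivalence `a ≲ b`. -/
def CuntzLE (a b : A) : Prop :=
  ∃ x : ℕ → A, Filter.Tendsto (fun n => star (x n) * b * x n) Filter.atTop (𝓝 a)

/-- Strictly positive elements: `a ≥ 0` and `aAa` is dense in `A`. -/
def IsStrictlyPos [PartialOrder A] (a : A) : Prop :=
  0 ≤ a ∧ Dense (Set.range fun x : A => a * x * a)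

/-- The function `f_ε`: `0` up to `ε/2`, `1` from `ε` on, linear in between. -/
def fcut (ε t : ℝ) : ℝ :=
  if t ≤ ε / 2 then 0 else if t ≤ ε then (t - ε / 2) / (ε / 2) else 1

end Basic

/-! ### One-dimensional non-commutative complexes -/

section Blocks

variable {F₁ F₂ : Type} [CStarAlgebra F₁] [CStarAlgebra F₂]

/-- `A(F₁, F₂, φ₀, φ₁) = {(f, g) ∈ C([0,1], F₂) ⊕ F₁ : f(0) = φ₀(g), f(1) = φ₁(g)}`. -/
def block (φ₀ φ₁ : F₁ →⋆ₙₐ[ℂ] F₂) : NonUnitalStarSubalgebra ℂ (C(I, F₂) × F₁) where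
  carrier := {x | x.1 0 = φ₀ x.2 ∧ x.1 1 = φ₁ x.2}
  add_mem' := by
    rintro a b ⟨h1, h2⟩ ⟨h3, h4⟩
    exact ⟨by simp [h1, h3], by simp [h2, h4]⟩
  zero_mem' := ⟨by simp, by simp⟩
  mul_mem' := by
    rintro a b ⟨h1, h2⟩ ⟨h3, h4⟩
    exact ⟨by simp [h1, h3], by simp [h2, h4]⟩
  smul_mem' := by
    rintro c a ⟨h1, h2⟩
    exact ⟨by simp [h1], by simp [h2]⟩
  star_mem' := by
    rintro a ⟨h1, h2⟩
    exact ⟨by simp [h1, map_star], by simp [h2, map_star]⟩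

/-- The class `𝒞`: C*-algebras isomorphic to some `A(F₁, F₂, φ₀, φ₁)` with `F₁`, `F₂`
finite-dimensional and `φ₀`, `φ₁` (not necessarily unital) *-homomorphisms. -/
def ClassC (C : Type u) [NonUnitalCStarAlgebra C] : Prop :=
  ∃ (F₁ F₂ : Type) (_ : CStarAlgebra F₁) (_ : CStarAlgebra F₂)
    (_ : FiniteDimensional ℂ F₁) (_ : FiniteDimensional ℂ F₂) (φ₀ φ₁ : F₁ →⋆ₙₐ[ℂ] F₂),
    Nonempty (C ≃⋆ₐ[ℂ] block φ₀ φ₁)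

/-- The class `𝒞₀`: non-zero algebras in `𝒞` with `K₁ = 0`, `K₀₊ = {0}` and such that `0` is not
in the weak* closure of the tracial states. -/
structure ClassC0 (C : Type u) [NonUnitalCStarAlgebra C] : Prop where
  nontrivial : Nontrivial C
  classC : ClassC C
  k1 : Subsingleton (K1 C)
  k0pos : K0Pos C = {0}
  zero_notMem : (0 : WeakDual ℂ C) ∉ closure (tracialStates C)

/-- The class `𝒞₀'`: full hereditary sub-C*-algebras of algebras in `𝒞₀`, up to isomorphism. -/
def ClassC0' (D : Type u) [NonUnitalCStarAlgebra D] : Prop :=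
  ∃ (C : Type) (_ : NonUnitalCStarAlgebra C) (H : NonUnitalStarSubalgebra ℂ C),
    ClassC0 C ∧ IsClosed (H : Set C) ∧ IsHereditary H ∧ IsFull H ∧ Nonempty (D ≃⋆ₐ[ℂ] H)

end Blocks

/-! ### The class `𝒟` -/

section ClassD

variable {A : Type u} [NonUnitalCStarAlgebra A] [PartialOrder A] [StarOrderedRing A]

/-- Contractive maps that are multiplicative on `F` up to `ε`. -/
def IsApproxMultContraction (F : Finset A) (ε : ℝ) (φ : A →CP A) : Prop :=
  (∀ x, ‖φ x‖ ≤ ‖x‖) ∧ ∀ x ∈ F, ∀ y ∈ F, ‖φ (x * y) - φ x * φ y‖ < ε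

/-- The approximation required in the definition of `𝒟`, for given `a, 𝔣, ε, F, b`.
A completely positive map `A → D` is a completely positive map `A → A` with values in `D`. -/
def HasTracialApprox (a : A) (𝔣 ε : ℝ) (F : Finset A) (b : A) : Prop :=
  ∃ (D : NonUnitalStarSubalgebra ℂ A) (_ : IsClosed (D : Set A)) (φ ψ : A →CP A)
    (hψ : ∀ x, ψ x ∈ D),
    ClassC0' D ∧
    IsApproxMultContraction F ε φ ∧ IsApproxMultContraction F ε ψ ∧
    (∀ x, ∀ d ∈ D, φ x * d = 0) ∧
    (∀ x ∈ F, ‖x - (φ x + ψ x)‖ < ε) ∧ ‖a - (φ a + ψ a)‖ < ε ∧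
    CuntzLE (φ a) b ∧
    ∀ t ∈ tracialStates D, (𝔣 : ℂ) ≤ t (cfcₙ (fcut (1 / 4)) (⟨ψ a, hψ a⟩ : D))

variable (A)

/-- The class `𝒟`. -/
def ClassD : Prop :=
  IsSimpleCStar A ∧ ∃ a : A, IsStrictlyPos a ∧ ‖a‖ = 1 ∧
    ∃ 𝔣 : ℝ, 0 < 𝔣 ∧ 𝔣 < 1 ∧
      ∀ (ε : ℝ), 0 < ε → ∀ (F : Finset A) (b : A), 0 ≤ b → b ≠ 0 → HasTracialApprox a 𝔣 ε F b

end ClassD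

/-- `A` is stably projectionless: no matrix algebra over `A` contains a non-zero projection. -/
def StablyProjectionless (A : Type u) [NonUnitalCStarAlgebra A] : Prop :=
  ∀ (n : ℕ) (p : CStarMatrix (Fin n) (Fin n) A), IsStarProjection p → p = 0

end GenTracialRank

end

/-! A projection over an algebra of `𝒟` is invisible to some faithful trace. The approximating maps
`ψ : A → D` send a matrix projection `p` to a self-adjoint matrix over `D` that is almost
idempotent. Since `D` is stably projectionless, functional calculus leaves such a matrix no choice
but to be small in norm (`norm_le_of_norm_mul_self_sub_le`). Composing `ψ` with a tracial state of
`D` gives functionals on `A` that are almost tracial and almost zero on the `p i i`, while the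
condition on `f_{1/4}(ψ a)` keeps them at least `𝔣 / 8` at `a`. A weak* cluster point `τ` is a
non-zero positive trace with `τ (p i i) = 0`. Simplicity of `A` makes `τ` faithful, and `p i i = ∑
k, star (p k i) * p k i` then forces `p = 0`.

That `D` is stably projectionless and has a tracial state comes from the finite-dimensional
representations of algebras in `𝒞`, which separate points. The regular trace of a finite-dimensional
C*-algebra is faithful, and pulled back along such a representation it induces a homomorphism on
`K₀`. A projection over `C` in `𝒞₀` has class `0`, so all these traces vanish on it and it is zero.
-/

open scoped CStarAlgebra ComplexOrder Topology unitInterval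

noncomputable section

namespace GenTracialRank

universe u v

/-! ### Faithful traces on finite-dimensional algebras -/

section FiniteDimensional

variable (F : Type u) [CStarAlgebra F]

/-- The trace of the left regular representation. -/
def regTrace : F →ₗ[ℂ] ℂ := LinearMap.trace ℂ F ∘ₗ LinearMap.mul ℂ F

variable {F}

theorem regTrace_mul_comm (x y : F) : regTrace F (x * y) = regTrace F (y * x) := by
  have h (a b : F) : LinearMap.mul ℂ F (a * b) = LinearMap.mul ℂ F a * LinearMap.mul ℂ F b := by
    ext z; simp [mul_assoc]
  simp only [regTrace, LinearMap.comp_apply, h]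
  exact LinearMap.trace_mul_comm ℂ _ _

/-- An eigenvector `w` of left multiplication satisfies `(z - star x * x) * w = 0`, so `z - star x *
x` is not invertible and `z` lies in the spectrum of a positive element. -/
theorem nonneg_of_mem_roots_charpoly_mul [FiniteDimensional ℂ F] (x : F) {z : ℂ}
    (hz : z ∈ (LinearMap.mul ℂ F (star x * x)).charpoly.roots) : 0 ≤ z := by
  have h1 : Module.End.HasEigenvalue (LinearMap.mul ℂ F (star x * x)) z :=
    (Module.End.hasEigenvalue_iff_isRoot_charpoly _ z).2 (Polynomial.isRoot_of_mem_roots hz)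
  obtain ⟨w, hw⟩ := h1.exists_hasEigenvector
  have h2 : z ∈ spectrum ℂ (star x * x) := by
    rw [spectrum.mem_iff]
    intro hu
    refine hw.2 (hu.mul_right_eq_zero.1 ?_)
    have := hw.apply_eq_smul
    simp only [LinearMap.mul_apply'] at this
    rw [sub_mul, this, Algebra.algebraMap_eq_smul_one, smul_mul_assoc, one_mul, sub_self]
  let _ := CStarAlgebra.spectralOrder F
  let _ := CStarAlgebra.spectralOrderedRing F
  exact spectrum_nonneg_of_nonneg (star_mul_self_nonneg x) h2

theorem regTrace_star_mul_self_nonneg [FiniteDimensional ℂ F] (x : F) :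
    0 ≤ regTrace F (star x * x) := by
  rw [regTrace, LinearMap.comp_apply,
    Module.End.trace_eq_sum_roots_charpoly_of_splits (IsAlgClosed.splits _)]
  exact Multiset.sum_nonneg fun z hz => nonneg_of_mem_roots_charpoly_mul x hz

/-- Non-negative eigenvalues with sum zero all vanish, so by Cayley–Hamilton `star x * x` is
nilpotent; a self-adjoint nilpotent is zero by the C*-identity. -/
theorem eq_zero_of_regTrace_star_mul_self [FiniteDimensional ℂ F] {x : F}
    (h : regTrace F (star x * x) = 0) : x = 0 := by
  rw [regTrace, LinearMap.comp_apply,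
    Module.End.trace_eq_sum_roots_charpoly_of_splits (IsAlgClosed.splits _)] at h
  have h0 : ∀ z ∈ (LinearMap.mul ℂ F (star x * x)).charpoly.roots, z = 0 :=
    Multiset.all_zero_of_le_zero_le_of_sum_eq_zero
      (fun _ hz => nonneg_of_mem_roots_charpoly_mul x hz) h
  have h1 : (LinearMap.mul ℂ F (star x * x)).charpoly.roots =
      Multiset.replicate (Module.finrank ℂ F) 0 := by
    rw [Multiset.eq_replicate]
    refine ⟨?_, h0⟩
    rw [← (IsAlgClosed.splits _).natDegree_eq_card_roots, LinearMap.charpoly_natDegree]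
  have h2 : (LinearMap.mul ℂ F (star x * x)).charpoly = Polynomial.X ^ Module.finrank ℂ F := by
    rw [(IsAlgClosed.splits _).eq_prod_roots_of_monic (LinearMap.charpoly_monic _), h1]
    simp
  have h3 := LinearMap.aeval_self_charpoly (LinearMap.mul ℂ F (star x * x))
  rw [h2] at h3
  have h4 : (star x * x) ^ Module.finrank ℂ F = 0 := by
    have h5 (k : ℕ) : ((LinearMap.mul ℂ F (star x * x)) ^ k) 1 = (star x * x) ^ k := by
      induction k with
      | zero => simp
      | succ k ih => rw [pow_succ', Module.End.mul_apply, ih, pow_succ', LinearMap.mul_apply']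
    rw [← h5]
    simpa using congrArg (fun f : Module.End ℂ F => f 1) h3
  have h5 : star x * x = 0 := by
    have h6 := (IsSelfAdjoint.star_mul_self x).nnnorm_pow_two_pow (Module.finrank ℂ F)
    rw [pow_eq_zero_of_le Nat.lt_two_pow_self.le h4, nnnorm_zero] at h6
    exact nnnorm_eq_zero.1 (eq_zero_of_pow_eq_zero h6.symm)
  exact CStarRing.star_mul_self_eq_zero_iff x |>.1 h5

end FiniteDimensional

/-! ### Traces on `K₀` -/

section TraceOnK0

theorem trace_dsum {B : Type u} [AddCommMonoid B] {n m : ℕ} (x : Matrix (Fin n) (Fin n) B)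
    (y : Matrix (Fin m) (Fin m) B) : (dsum x y).trace = x.trace + y.trace := by
  simp [dsum, Matrix.trace, Fin.sum_univ_add]

theorem map_trace_mul_comm {B : Type u} [NonUnitalRing B] {G : Type v} [AddCommGroup G]
    (τ : B →+ G) (hτ : ∀ x y, τ (x * y) = τ (y * x)) {n m : ℕ}
    (x : Matrix (Fin n) (Fin m) B) (y : Matrix (Fin m) (Fin n) B) :
    τ (x * y).trace = τ (y * x).trace := by
  simp only [Matrix.trace, Matrix.diag, Matrix.mul_apply, map_sum]
  rw [Finset.sum_comm]
  simp only [hτ]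

/-- The homomorphism `K₀(B) → G`, `[p] ↦ τ(Tr p)`, induced by a trace `τ : B → G`. -/
def K0Unital.trace {B : Type u} [Ring B] [StarRing B] {G : Type v} [AddCommGroup G]
    (τ : B →+ G) (hτ : ∀ x y, τ (x * y) = τ (y * x)) : K0Unital B →+ G :=
  QuotientAddGroup.lift _ (FreeAbelianGroup.lift fun p : MatProj B => τ p.2.1.trace) <| by
    rw [AddSubgroup.closure_le]
    rintro _ (⟨p, q, ⟨w, h1, h2⟩, rfl⟩ | ⟨p, q, rfl⟩)
    · simp [← h1, ← h2, map_trace_mul_comm τ hτ w]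
    · simp [MatProj.sum, trace_dsum]

@[simp]
theorem K0Unital.trace_mk {B : Type u} [Ring B] [StarRing B] {G : Type v} [AddCommGroup G]
    (τ : B →+ G) (hτ : ∀ x y, τ (x * y) = τ (y * x)) (p : MatProj B) :
    K0Unital.trace τ hτ (K0Unital.mk p) = τ p.2.1.trace := by
  simp [K0Unital.trace, K0Unital.mk]

theorem K0Unital.mk_eq_of_mvN {B : Type u} [Ring B] [StarRing B] {p q : MatProj B}
    (h : MvN p q) : K0Unital.mk p = K0Unital.mk q := by
  rw [K0Unital.mk, K0Unital.mk, ← sub_eq_zero, ← QuotientAddGroup.mk_sub,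
    QuotientAddGroup.eq_zero_iff]
  exact AddSubgroup.subset_closure (Or.inl ⟨p, q, h, rfl⟩)

theorem K0Unital.mk_sum {B : Type u} [Ring B] [StarRing B] (p q : MatProj B) :
    K0Unital.mk (p.sum q) = K0Unital.mk p + K0Unital.mk q := by
  rw [← sub_eq_zero, K0Unital.mk, K0Unital.mk, K0Unital.mk, ← QuotientAddGroup.mk_add,
    ← QuotientAddGroup.mk_sub, QuotientAddGroup.eq_zero_iff]
  exact AddSubgroup.subset_closure (Or.inr ⟨p, q, rfl⟩)

/-- The zero matrix `v` implements `p ⊕ p ~ p` when `p = 0`, whence `2[p] = [p]`. -/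
theorem K0Unital.mk_eq_zero {B : Type u} [Ring B] [StarRing B] {p : MatProj B}
    (h : p.2.1 = 0) : K0Unital.mk p = 0 := by
  have h1 : K0Unital.mk (p.sum p) = K0Unital.mk p :=
    K0Unital.mk_eq_of_mvN ⟨0, by
      constructor
      · rw [Matrix.mul_zero]
        change 0 = dsum p.2.1 p.2.1
        simp [h, dsum]
      · rw [Matrix.zero_mul, h]⟩
  simpa [K0Unital.mk_sum] using h1

end TraceOnK0

/-! ### Traces and projections of one-dimensional complexes -/

section ClassC

/-- Point evaluations into `F₂` and the projection onto `F₁` separate the points of a block. -/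
theorem ClassC.exists_hom_ne_zero {C : Type u} [NonUnitalCStarAlgebra C] (hC : ClassC C)
    {x : C} (hx : x ≠ 0) :
    ∃ (F : Type) (_ : CStarAlgebra F) (_ : FiniteDimensional ℂ F) (π : C →⋆ₙₐ[ℂ] F),
      π x ≠ 0 := by
  obtain ⟨F₁, F₂, i₁, i₂, j₁, j₂, φ₀, φ₁, ⟨e⟩⟩ := hC
  let ι : C →⋆ₙₐ[ℂ] C(I, F₂) × F₁ :=
    (NonUnitalStarSubalgebraClass.subtype (block φ₀ φ₁)).comp (e : C →⋆ₙₐ[ℂ] block φ₀ φ₁)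
  have hι : ι x ≠ 0 := fun h => hx ((map_eq_zero_iff e e.injective).1 (Subtype.ext h))
  by_cases h2 : (ι x).2 = 0
  · have h1 : (ι x).1 ≠ 0 := fun h1 => hι (Prod.ext h1 h2)
    obtain ⟨t, ht⟩ : ∃ t, (ι x).1 t ≠ 0 := by
      by_contra! h
      exact h1 (ContinuousMap.ext h)
    let ev : C(I, F₂) →⋆ₙₐ[ℂ] F₂ :=
      { toFun := fun f => f t
        map_smul' := fun _ _ => rfl
        map_zero' := rfl
        map_add' := fun _ _ => rfl
        map_mul' := fun _ _ => rfl
        map_star' := fun _ => rfl }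
    exact ⟨F₂, i₂, j₂, (ev.comp (NonUnitalStarAlgHom.fst ℂ _ _)).comp ι, ht⟩
  · exact ⟨F₁, i₁, j₁, (NonUnitalStarAlgHom.snd ℂ _ _).comp ι, h2⟩

theorem isStarProjection_apply_self {B : Type u} [NonUnitalRing B] [StarRing B] {n : ℕ}
    {p : Matrix (Fin n) (Fin n) B} (hp : IsStarProjection p) (i : Fin n) :
    p i i = ∑ j, star (p j i) * p j i := by
  have h1 : star p * p = p := by rw [hp.isSelfAdjoint.star_eq, hp.isIdempotentElem.eq]
  conv_lhs => rw [← h1, Matrix.mul_apply]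
  rfl

theorem ClassC0.eq_zero_of_isStarProjection {C : Type u} [NonUnitalCStarAlgebra C]
    (hC : ClassC0 C) {n : ℕ} {p : Matrix (Fin n) (Fin n) C} (hp : IsStarProjection p) :
    p = 0 := by
  let P : MatProj C := ⟨n, p, hp⟩
  let Q := P.map (Unitization.inrNonUnitalAlgHom ℂ C : C →ₙ+* Unitization ℂ C)
      (fun a => Unitization.inr_star a)
  -- The entries of `Q` lie in `C`, so its scalar part is the zero matrix.
  have hK : K0Unital.mk Q ∈ K0 C := by
    rw [K0, AddMonoidHom.mem_ker]
    have : K0Unital.map ((Unitization.fstHom ℂ C : Unitization ℂ C →+* ℂ) :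
        Unitization ℂ C →ₙ+* ℂ) (fun x => Unitization.fst_star x) (K0Unital.mk Q) =
        K0Unital.mk (Q.map ((Unitization.fstHom ℂ C : Unitization ℂ C →+* ℂ) :
          Unitization ℂ C →ₙ+* ℂ) (fun x => Unitization.fst_star x)) := by
      simp [K0Unital.map, K0Unital.mk, FreeAbelianGroup.map_of_apply]
    rw [this]
    apply K0Unital.mk_eq_zero
    ext i j
    rfl
  have hQ : K0Unital.mk Q = 0 := by
    have : (⟨K0Unital.mk Q, hK⟩ : K0 C) ∈ K0Pos C := ⟨P, rfl⟩
    rw [hC.k0pos] at this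
    exact congrArg Subtype.val this
  ext i j
  by_contra hij
  obtain ⟨F, _, _, π, hπ⟩ := hC.classC.exists_hom_ne_zero hij
  let Φ := Unitization.starLift π
  let τ : Unitization ℂ C →+ ℂ := (regTrace F).toAddMonoidHom.comp (Φ : Unitization ℂ C →+ F)
  have hτ : ∀ x y, τ (x * y) = τ (y * x) := fun x y => by
    simp [τ, regTrace_mul_comm (Φ x)]
  have h0 : τ Q.2.1.trace = 0 := by
    rw [← K0Unital.trace_mk τ hτ, hQ, map_zero]
  -- The trace of `p` is a sum of terms `star (p l k) * p l k`, so its vanishing kills each entry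
  -- under the faithful `regTrace`.
  have h1 : ∑ k, ∑ l, regTrace F (star (π (p l k)) * π (p l k)) = 0 := by
    rw [← h0]
    simp only [Matrix.trace, Matrix.diag, map_sum]
    refine Finset.sum_congr rfl fun k _ => ?_
    have : τ (Q.2.1 k k) = regTrace F (π (p k k)) :=
      congrArg (regTrace F) (DFunLike.congr_fun (Unitization.starLift.symm_apply_apply π) (p k k))
    rw [this, isStarProjection_apply_self hp k]
    simp [map_star]
  have h2 := (Finset.sum_eq_zero_iff_of_nonneg fun k _ => Finset.sum_nonneg fun l _ =>
    regTrace_star_mul_self_nonneg (π (p l k))).1 h1 j (Finset.mem_univ _)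
  have h3 := (Finset.sum_eq_zero_iff_of_nonneg fun l _ =>
    regTrace_star_mul_self_nonneg (π (p l j))).1 h2 i (Finset.mem_univ _)
  exact hπ (eq_zero_of_regTrace_star_mul_self h3)

theorem ClassC0.stablyProjectionless {C : Type u} [NonUnitalCStarAlgebra C] (hC : ClassC0 C) :
    StablyProjectionless C :=
  fun _ _ hp => hC.eq_zero_of_isStarProjection ⟨hp.1, hp.2⟩

theorem StablyProjectionless.of_injective {C : Type u} {D : Type v} [NonUnitalCStarAlgebra C]
    [NonUnitalCStarAlgebra D] (hC : StablyProjectionless C) (f : D →⋆ₙₐ[ℂ] C)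
    (hf : Function.Injective f) : StablyProjectionless D := by
  intro n p hp
  have hp' : IsStarProjection (show Matrix (Fin n) (Fin n) D from p) := ⟨hp.1, hp.2⟩
  have h := isStarProjection_map (f : D →ₙ+* C) (fun b => map_star f b) hp'
  have h0 := hC n _ ⟨h.1, h.2⟩
  refine CStarMatrix.ext fun i j => hf ?_
  rw [CStarMatrix.zero_apply, map_zero]
  exact congrFun (congrFun h0 i) j

/-- A full hereditary subalgebra of an algebra in `𝒞₀` is non-zero and embeds into it. -/
theorem ClassC0'.exists_embedding {D : Type u} [NonUnitalCStarAlgebra D] (hD : ClassC0' D) :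
    Nontrivial D ∧ ∃ (C : Type) (_ : NonUnitalCStarAlgebra C) (f : D →⋆ₙₐ[ℂ] C),
      ClassC0 C ∧ Function.Injective f := by
  obtain ⟨C, iC, H, hC, -, -, hfull, ⟨e⟩⟩ := hD
  refine ⟨?_, C, iC, (NonUnitalStarSubalgebraClass.subtype H).comp (e : D →⋆ₙₐ[ℂ] H), hC,
    Subtype.val_injective.comp e.injective⟩
  by_contra hD
  rw [not_nontrivial_iff_subsingleton] at hD
  have hH : Subsingleton H := e.symm.injective.subsingleton
  -- If `H` were zero, fullness would make the zero ideal all of `C`.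
  have h1 := hfull ⊥ (by simp) (by
    intro x hx
    have : (⟨x, hx⟩ : H) = 0 := Subsingleton.elim _ _
    have : x = 0 := congrArg Subtype.val this
    simp [this])
  obtain ⟨x, hx⟩ := @exists_ne C hC.nontrivial 0
  have : x ∈ (⊤ : TwoSidedIdeal C) := trivial
  rw [← h1] at this
  exact hx (by simpa using this)

theorem ClassC0'.stablyProjectionless {D : Type u} [NonUnitalCStarAlgebra D]
    (hD : ClassC0' D) : StablyProjectionless D := by
  obtain ⟨-, C, _, f, hC, hf⟩ := hD.exists_embedding
  exact hC.stablyProjectionless.of_injective f hf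

/-- The regular trace, pulled back along a finite-dimensional representation that does not kill a
chosen `x`, is non-zero at `star x * x`; it remains to normalise it. -/
theorem ClassC0'.tracialStates_nonempty {D : Type u} [NonUnitalCStarAlgebra D]
    (hD : ClassC0' D) : (tracialStates D).Nonempty := by
  obtain ⟨hn, C, _, f, hC, hf⟩ := hD.exists_embedding
  obtain ⟨x, hx⟩ := exists_ne (0 : D)
  obtain ⟨F, _, _, π, hπ⟩ := hC.classC.exists_hom_ne_zero
    (fun h => hx (hf (h.trans (map_zero f).symm)))
  let ρ : D →⋆ₙₐ[ℂ] F := π.comp f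
  let T : D →L[ℂ] ℂ := (LinearMap.toContinuousLinearMap (regTrace F)).comp
    ⟨(ρ : D →ₗ[ℂ] F), (map_continuous ρ)⟩
  have hT (d : D) : T d = regTrace F (ρ d) := rfl
  have hT0 : T ≠ 0 := fun h => hπ <| eq_zero_of_regTrace_star_mul_self (x := ρ x) <| by
    have := congrArg (fun S : D →L[ℂ] ℂ => S (star x * x)) h
    simpa [hT, map_star] using this
  have hpos : 0 < ‖T‖ := norm_pos_iff.2 hT0
  refine ⟨StrongDual.toWeakDual (((‖T‖⁻¹ : ℝ) : ℂ) • T), fun a => ?_, fun a b => ?_, ?_⟩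
  · change 0 ≤ ((‖T‖⁻¹ : ℝ) : ℂ) * T (star a * a)
    refine mul_nonneg (by exact_mod_cast (inv_pos.2 hpos).le) ?_
    rw [hT, map_mul ρ, map_star ρ]
    exact regTrace_star_mul_self_nonneg _
  · change ((‖T‖⁻¹ : ℝ) : ℂ) * T (a * b) = ((‖T‖⁻¹ : ℝ) : ℂ) * T (b * a)
    rw [hT, hT, map_mul ρ, map_mul ρ, regTrace_mul_comm]
  · change ‖((‖T‖⁻¹ : ℝ) : ℂ) • T‖ = 1
    rw [norm_smul, Complex.norm_real, norm_inv, norm_norm, inv_mul_cancel₀ hpos.ne']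

end ClassC

/-! ### Almost projections in projectionless algebras -/

section AlmostProjections

/-- The spectrum avoids `1 / 2`, where `|t * t - t| = 1 / 4`. Hence the indicator of `t > 1 / 2` is
continuous on it and yields a projection, which must be zero. So `t ≤ 1 / 2` throughout, and `|t| *
(1 - t) ≤ δ` gives `|t| ≤ 2 * δ`. -/
theorem norm_le_of_norm_mul_self_sub_le {B : Type u} [NonUnitalCStarAlgebra B]
    (hB : ∀ p : B, IsStarProjection p → p = 0) {m : B} (hm : IsSelfAdjoint m) {δ : ℝ}
    (hδ : δ < 1 / 4) (h : ‖m * m - m‖ ≤ δ) : ‖m‖ ≤ 2 * δ := by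
  have h1 : cfcₙ (fun t : ℝ => t * t - t) m = m * m - m := by
    rw [cfcₙ_sub (fun t : ℝ => t * t) (fun t : ℝ => t) m,
      cfcₙ_mul (fun t : ℝ => t) (fun t : ℝ => t) m, cfcₙ_id' ℝ m]
  have h2 : ∀ t ∈ quasispectrum ℝ m, |t * t - t| ≤ δ := fun t ht =>
    (norm_apply_le_norm_cfcₙ (fun t : ℝ => t * t - t) m ht).trans (h1 ▸ h)
  let f : ℝ → ℝ := fun t => if 1 / 2 < t then 1 else 0
  have hf : ContinuousOn f (quasispectrum ℝ m) := by
    intro t ht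
    refine ContinuousAt.continuousWithinAt ?_
    have h3 := abs_le.1 (h2 t ht)
    rcases lt_trichotomy t (1 / 2) with h4 | h4 | h4
    · exact (continuousAt_const (y := (0 : ℝ))).congr <|
        (Filter.eventually_of_mem (Iio_mem_nhds h4) fun s hs => by
          simp only [f]; rw [if_neg (not_lt.2 (le_of_lt hs))])
    · subst h4; linarith
    · exact (continuousAt_const (y := (1 : ℝ))).congr <|
        (Filter.eventually_of_mem (Ioi_mem_nhds h4) fun s hs => by
          simp only [f]; rw [if_pos (Set.mem_Ioi.1 hs)])
  have hf0 : f 0 = 0 := by simp [f]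
  have hproj : IsStarProjection (cfcₙ f m) := by
    refine ⟨?_, cfcₙ_predicate f m⟩
    change cfcₙ f m * cfcₙ f m = cfcₙ f m
    rw [← cfcₙ_mul f f m]
    refine cfcₙ_congr fun t _ => ?_
    simp only [f]
    split_ifs <;> simp
  have h3 : ∀ t ∈ quasispectrum ℝ m, t ≤ 1 / 2 := by
    intro t ht
    have h4 := norm_apply_le_norm_cfcₙ f m ht
    rw [hB _ hproj, norm_zero] at h4
    by_contra! h5
    simp only [f] at h4
    rw [if_pos h5] at h4
    norm_num at h4
  rw [← cfcₙ_id' ℝ m]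
  refine norm_cfcₙ_le fun t ht => ?_
  have h4 := h2 t ht
  have h5 := h3 t ht
  rw [show t * t - t = -(t * (1 - t)) by ring, abs_neg, abs_mul,
    abs_of_pos (by linarith : 0 < 1 - t)] at h4
  rw [Real.norm_eq_abs]
  nlinarith [abs_nonneg t]

theorem norm_cstarMatrix_le_sum {A : Type u} [NonUnitalCStarAlgebra A] [PartialOrder A]
    [StarOrderedRing A] {n : ℕ} (M : CStarMatrix (Fin n) (Fin n) A) :
    ‖M‖ ≤ ∑ j, ∑ i, ‖M i j‖ := by
  rw [CStarMatrix.norm_def]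
  refine (CStarMatrix.toCLM M).opNorm_le_bound (by positivity) fun w => ?_
  simp only [CStarMatrix.toCLM_apply_eq_sum, Finset.sum_mul]
  apply (WithCStarModule.pi_norm_le_sum_norm _).trans
  gcongr with i _
  change ‖∑ j, w j * M j i‖ ≤ _
  apply (norm_sum_le _ _).trans
  gcongr with j _
  apply (norm_mul_le _ _).trans
  rw [mul_comm]
  gcongr
  exact WithCStarModule.norm_apply_le_norm w j

theorem StablyProjectionless.norm_apply_le {D : Type u} [NonUnitalCStarAlgebra D]
    (hD : StablyProjectionless D) {n : ℕ} {M : Matrix (Fin n) (Fin n) D}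
    (hM : ∀ i j, star (M j i) = M i j) {ε : ℝ} (hε : n * (n * ε) < 1 / 4)
    (h : ∀ i j, ‖(M * M) i j - M i j‖ ≤ ε) (i j : Fin n) : ‖M i j‖ ≤ 2 * (n * (n * ε)) := by
  let _ := CStarAlgebra.spectralOrder D
  let _ := CStarAlgebra.spectralOrderedRing D
  let M' : CStarMatrix (Fin n) (Fin n) D := CStarMatrix.ofMatrix M
  have hM' : IsSelfAdjoint M' := CStarMatrix.ext hM
  refine (CStarMatrix.norm_entry_le_norm (M := M') (i := i) (j := j)).trans
    (norm_le_of_norm_mul_self_sub_le (hD n) hM' hε ((norm_cstarMatrix_le_sum _).trans ?_))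
  calc ∑ j, ∑ i, ‖(M' * M' - M') i j‖ ≤ ∑ _j : Fin n, ∑ _i : Fin n, ε :=
        Finset.sum_le_sum fun j _ => Finset.sum_le_sum fun i _ => h i j
    _ = n * (n * ε) := by simp

end AlmostProjections

/-! ### Positive functionals -/

section Functionals

/-- Since `f x ≥ 0`, functional calculus gives `f |x| = f x`, so `x = |x|`. This transfers
positivity from `A` to a subalgebra, in the form in which positivity of functionals is stated. -/
theorem exists_eq_star_mul_self_of_map_nonneg {D : Type u} {A : Type v}
    [NonUnitalCStarAlgebra D] [NonUnitalCStarAlgebra A] [PartialOrder A] [StarOrderedRing A]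
    (f : D →⋆ₙₐ[ℂ] A) (hf : Function.Injective f) {x : D} (hx : 0 ≤ f x) :
    ∃ y, x = star y * y := by
  let _ := CStarAlgebra.spectralOrder D
  let _ := CStarAlgebra.spectralOrderedRing D
  have hs : IsSelfAdjoint x := hf (by rw [map_star, (IsSelfAdjoint.of_nonneg hx).star_eq])
  have h1 : f (cfcₙ (fun t : ℝ => |t|) x) = f x := by
    rw [NonUnitalStarAlgHom.map_cfcₙ f (fun t : ℝ => |t|) x (by fun_prop) (by simp)
      (map_continuous f) hs (IsSelfAdjoint.of_nonneg hx)]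
    conv_rhs => rw [← cfcₙ_id' ℝ (f x)]
    exact cfcₙ_congr fun t ht => abs_of_nonneg (quasispectrum_nonneg_of_nonneg _ hx t ht)
  rw [← hf h1, ← CStarAlgebra.nonneg_iff_eq_star_mul_self]
  exact cfcₙ_nonneg fun t _ => abs_nonneg t

theorem continuous_fcut {ε : ℝ} (hε : 0 < ε) : Continuous (fcut ε) := by
  have h : fcut ε = fun t => max 0 (min ((t - ε / 2) / (ε / 2)) 1) := by
    funext t
    simp only [fcut]
    split_ifs with h1 h2
    · have : (t - ε / 2) / (ε / 2) ≤ 0 := div_nonpos_of_nonpos_of_nonneg (by linarith) (by linarith)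
      rw [max_eq_left ((min_le_left _ _).trans this)]
    · have h3 : (t - ε / 2) / (ε / 2) ≤ 1 := by rw [div_le_one (by linarith)]; linarith
      have h4 : 0 ≤ (t - ε / 2) / (ε / 2) := div_nonneg (by linarith) (by linarith)
      rw [min_eq_left h3, max_eq_right h4]
    · have h3 : 1 ≤ (t - ε / 2) / (ε / 2) := by rw [one_le_div (by linarith)]; linarith
      rw [min_eq_right h3, max_eq_right zero_le_one]
  rw [h]
  fun_prop

theorem fcut_le {ε t : ℝ} (hε : 0 < ε) (ht : 0 ≤ t) : fcut ε t ≤ 2 / ε * t := by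
  have h0 : 0 ≤ 2 / ε * t := by positivity
  simp only [fcut]
  split_ifs with h1 h2
  · exact h0
  · rw [show (t - ε / 2) / (ε / 2) = 2 / ε * t - 1 by field_simp]
    linarith
  · rw [div_mul_eq_mul_div, le_div_iff₀ hε]
    linarith

variable {D : Type u} [NonUnitalCStarAlgebra D]

/-- This turns the lower bound on `f_{1/4}(ψ a)` into one on `ψ a` itself, which, unlike the first,
is linear in the functional and survives weak* limits. -/
theorem map_cfcₙ_fcut_le {t : D →ₗ[ℂ] ℂ} (ht : ∀ d, 0 ≤ t (star d * d)) (y : D) {ε : ℝ}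
    (hε : 0 < ε) : t (cfcₙ (fcut ε) (star y * y)) ≤ (2 / ε : ℝ) * t (star y * y) := by
  let _ := CStarAlgebra.spectralOrder D
  let _ := CStarAlgebra.spectralOrderedRing D
  set x := star y * y
  have hx : 0 ≤ x := star_mul_self_nonneg y
  have hs : IsSelfAdjoint x := IsSelfAdjoint.of_nonneg hx
  have hc := continuous_fcut hε
  have h0 : fcut ε 0 = 0 := if_pos (by positivity)
  have h1 : cfcₙ (fcut ε) x ≤ cfcₙ (fun s : ℝ => (2 / ε) * s) x :=
    cfcₙ_mono (fun s hs => fcut_le hε (quasispectrum_nonneg_of_nonneg _ hx s hs))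
      hc.continuousOn (by fun_prop) h0 (by simp)
  rw [cfcₙ_const_mul_id (2 / ε : ℝ) x] at h1
  obtain ⟨z, hz⟩ := CStarAlgebra.nonneg_iff_eq_star_mul_self.1 (sub_nonneg.2 h1)
  have h2 := ht z
  rw [← hz, map_sub, sub_nonneg] at h2
  rwa [← Complex.coe_smul (2 / ε) x, map_smul, smul_eq_mul] at h2

/-- A positive functional vanishing on `x*x` vanishes on `x*y`. -/
theorem map_star_mul_eq_zero {t : D →ₗ[ℂ] ℂ} (ht : ∀ d, 0 ≤ t (star d * d)) {x : D}
    (hx : t (star x * x) = 0) (y : D) : t (star x * y) = 0 := by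
  -- Positivity at `c • x + y`; the term quadratic in `c` vanishes by `hx`.
  have key (c : ℂ) : 0 ≤ star c * t (star x * y) + c * t (star y * x) + t (star y * y) := by
    have h := ht (c • x + y)
    simp only [star_add, star_smul, add_mul, mul_add, smul_mul_assoc, mul_smul_comm, map_add,
      map_smul, smul_eq_mul, hx, mul_zero, zero_add] at h
    convert h using 1
    ring
  set p := t (star x * y)
  set q := t (star y * x)
  set w := t (star y * y)
  have hw : 0 ≤ w := ht y
  -- A real-affine function that is non-negative on the whole line is constant. Real and imaginary
  -- `c` in `key` then give `p + q = 0` and `q - p = 0`.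
  have lin (z : ℂ) (hz : ∀ r : ℝ, 0 ≤ r * z + w) : z = 0 := by
    have him : z.im = 0 := by
      have h1 := (Complex.le_def.1 (hz 1)).2
      have h2 := (Complex.le_def.1 hw).2
      simp at h1 h2
      linarith
    have hre : z.re = 0 := by
      by_contra hne
      have h1 := (Complex.le_def.1 (hz (-(w.re + 1) / z.re))).1
      simp only [Complex.zero_re, Complex.add_re, Complex.re_ofReal_mul] at h1
      rw [div_mul_cancel₀ _ hne] at h1
      linarith
    exact Complex.ext hre him
  have h1 : p + q = 0 := lin _ fun r => by
    convert key r using 1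
    simp
    ring
  have h2 : Complex.I * (q - p) = 0 := lin _ fun r => by
    convert key (r * Complex.I) using 1
    simp
    ring
  have h3 : q - p = 0 := by simpa using h2
  linear_combination (h1 - h3) / 2

end Functionals

/-! ### Faithfulness of traces on simple algebras -/

section Simple

variable {A : Type u} [NonUnitalCStarAlgebra A]

/-- By the trace property, the `x` with `τ (x * y) = 0` for all `y` form a closed two-sided ideal;
it does not contain `a`, so it is zero. -/
theorem IsSimpleCStar.eq_zero_of_forall_map_mul (hA : IsSimpleCStar A) {τ : A →L[ℂ] ℂ}
    (hτ : ∀ x y, τ (x * y) = τ (y * x)) {a b : A} (h : τ (a * b) ≠ 0) {x : A}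
    (hx : ∀ y, τ (x * y) = 0) : x = 0 := by
  let N : TwoSidedIdeal A := TwoSidedIdeal.mk' {x | ∀ y, τ (x * y) = 0}
    (fun y => by simp)
    (fun {x z} hx hz y => by rw [add_mul, map_add, hx, hz, add_zero])
    (fun {x} hx y => by rw [neg_mul, map_neg, hx, neg_zero])
    (fun {x z} hz y => by rw [mul_assoc, hτ, mul_assoc, hz])
    (fun {x z} hx y => by rw [mul_assoc, hx])
  have hN : (N : Set A) = {x | ∀ y, τ (x * y) = 0} := TwoSidedIdeal.coe_mk' ..
  have hcl : IsClosed (N : Set A) := by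
    rw [hN, Set.ofPred_forall]
    exact isClosed_iInter fun y => isClosed_eq (by fun_prop) continuous_const
  have hxN : x ∈ (N : Set A) := by rw [hN]; exact hx
  rcases hA.2 N hcl with h1 | h1
  · rw [h1] at hxN
    simpa using hxN
  · have : a ∈ (N : Set A) := by rw [h1]; trivial
    rw [hN] at this
    exact absurd (this b) h

theorem IsSimpleCStar.eq_zero_of_trace_eq_zero (hA : IsSimpleCStar A) {τ : A →L[ℂ] ℂ}
    (hpos : ∀ x, 0 ≤ τ (star x * x)) (hτ : ∀ x y, τ (x * y) = τ (y * x)) {a b : A}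
    (h : τ (a * b) ≠ 0) {x : A} (hx : τ (star x * x) = 0) : x = 0 :=
  star_eq_zero.1 <| hA.eq_zero_of_forall_map_mul hτ h fun y =>
    map_star_mul_eq_zero (t := τ.toLinearMap) hpos hx y

end Simple

/-! ### The class `𝒟` -/

section ClassD

variable {A : Type u} [NonUnitalCStarAlgebra A] [PartialOrder A] [StarOrderedRing A]

/-- Composing a tracial state of `D` with `ψ : A → D` gives a functional on `A` that is almost
tracial on `F`, bounded below at `a`, and almost zero on the projections with entries in `F`. -/
theorem HasTracialApprox.exists_functional {a b : A} {𝔣 ε : ℝ} {F : Finset A}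
    (h : HasTracialApprox a 𝔣 ε F b) (ha : 0 ≤ a) {n : ℕ} {p : CStarMatrix (Fin n) (Fin n) A}
    (hp : IsStarProjection p) (hpF : ∀ i j, p i j ∈ F) (hε : n * (n * (n * ε)) < 1 / 4) :
    ∃ ω : A →L[ℂ] ℂ, ‖ω‖ ≤ 1 ∧ (∀ x, 0 ≤ ω (star x * x)) ∧ ((𝔣 / 8 : ℝ) : ℂ) ≤ ω a ∧
      (∀ i, ‖ω (p i i)‖ ≤ 2 * (n * (n * (n * ε)))) ∧
      ∀ x ∈ F, ∀ y ∈ F, ‖ω (x * y) - ω (y * x)‖ ≤ 2 * ε := by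
  obtain ⟨D, hDc, φ, ψ, hψ, hD, -, ⟨hψn, hψm⟩, -, -, -, -, hT⟩ := h
  obtain ⟨t, ht⟩ := hD.tracialStates_nonempty
  have htf := hT t ht
  obtain ⟨htp, htt, htn⟩ := ht
  let t' : D →L[ℂ] ℂ := WeakDual.toStrongDual t
  replace htn : ‖t'‖ = 1 := htn
  let Ψ : A →L[ℂ] D := LinearMap.mkContinuous
    { toFun := fun x => ⟨ψ x, hψ x⟩
      map_add' := fun x y => Subtype.ext (map_add ψ x y)
      map_smul' := fun c x => Subtype.ext (map_smul ψ c x) } 1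
    (fun x => by rw [one_mul]; exact hψn x)
  have hΨn : ‖Ψ‖ ≤ 1 := LinearMap.mkContinuous_norm_le _ zero_le_one _
  have hΨp {x : A} (hx : 0 ≤ x) : ∃ y, Ψ x = star y * y :=
    exists_eq_star_mul_self_of_map_nonneg (NonUnitalStarSubalgebraClass.subtype D) Subtype.val_injective
      (map_nonneg ψ hx)
  have hΨm {x y : A} (hx : x ∈ F) (hy : y ∈ F) : ‖Ψ (x * y) - Ψ x * Ψ y‖ ≤ ε :=
    (hψm x hx y hy).le
  have ht1 (d : D) : ‖t' d‖ ≤ ‖d‖ := by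
    simpa [htn] using t'.le_opNorm d
  refine ⟨t'.comp Ψ, ?_, fun x => ?_, ?_, fun i => ?_, fun x hx y hy => ?_⟩
  · exact (t'.opNorm_comp_le Ψ).trans (by rw [htn, one_mul]; exact hΨn)
  · obtain ⟨y, hy⟩ := hΨp (star_mul_self_nonneg x)
    rw [ContinuousLinearMap.comp_apply, hy]
    exact htp y
  · obtain ⟨y, hy⟩ := hΨp ha
    -- The factor `2 / (1 / 4) = 8` is the source of `𝔣 / 8`.
    have h1 := map_cfcₙ_fcut_le (t := t'.toLinearMap) htp y (ε := 1 / 4) (by norm_num)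
    rw [← hy] at h1
    have h2 : (𝔣 : ℂ) ≤ ((2 / (1 / 4) : ℝ) : ℂ) * t' (Ψ a) := htf.trans h1
    have h3 := mul_le_mul_of_nonneg_left h2
      (show (0 : ℂ) ≤ ((1 / 8 : ℝ) : ℂ) by exact_mod_cast (by norm_num : (0 : ℝ) ≤ 1 / 8))
    convert h3 using 1
    · push_cast; ring
    · rw [← mul_assoc, ← Complex.ofReal_mul]
      norm_num
  · refine (ht1 _).trans ?_
    have hstar (k l : Fin n) : star (Ψ (p l k)) = Ψ (p k l) := by
      -- Complete positivity enters here: the amplified `ψ` keeps `p` positive.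
      have h1 : IsSelfAdjoint (p.map ψ) :=
        IsSelfAdjoint.of_nonneg (ψ.map_cstarMatrix_nonneg p hp.nonneg)
      refine Subtype.ext ?_
      exact congrFun (congrFun h1.star_eq k) l
    refine hD.stablyProjectionless.norm_apply_le (M := Matrix.of fun k l => Ψ (p k l)) hstar hε
      (fun k l => ?_) i i
    -- Each entry of `p * p` is a sum of `n` products, so the entrywise defect is `n * ε`; this
    -- accounts for the third factor `n` in `hε`.
    have h1 : Ψ (p k l) = ∑ m, Ψ (p k m * p m l) := by
      rw [← map_sum]
      congr 1
      conv_lhs => rw [← hp.isIdempotentElem.eq]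
      rfl
    have h2 : (Matrix.of fun k l => Ψ (p k l)) k l = ∑ m, Ψ (p k m * p m l) := h1
    rw [h2, Matrix.mul_apply, ← Finset.sum_sub_distrib]
    calc _ ≤ ∑ _m : Fin n, ε := norm_sum_le_of_le _ fun m _ => by
            rw [norm_sub_rev]
            exact hΨm (hpF k m) (hpF m l)
      _ = n * ε := by simp
  · have h1 : t' (Ψ x * Ψ y) = t' (Ψ y * Ψ x) := htt _ _
    have h2 : t' (Ψ (x * y)) - t' (Ψ (y * x)) =
        t' (Ψ (x * y) - Ψ x * Ψ y) - t' (Ψ (y * x) - Ψ y * Ψ x) := by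
      rw [map_sub, map_sub, h1]; ring
    change ‖t' (Ψ (x * y)) - t' (Ψ (y * x))‖ ≤ 2 * ε
    rw [h2, two_mul]
    exact (norm_sub_le _ _).trans
      (add_le_add ((ht1 _).trans (hΨm hx hy)) ((ht1 _).trans (hΨm hy hx)))

/-- An algebra in `𝒟` has a bounded trace that is non-zero at `a` and vanishes on a given
projection. -/
theorem exists_trace_of_hasTracialApprox {a : A} {𝔣 : ℝ} (ha : 0 ≤ a)
    (h : ∀ ε : ℝ, 0 < ε → ∀ F : Finset A, HasTracialApprox a 𝔣 ε F a) {n : ℕ}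
    {p : CStarMatrix (Fin n) (Fin n) A} (hp : IsStarProjection p) :
    ∃ τ : A →L[ℂ] ℂ, (∀ x, 0 ≤ τ (star x * x)) ∧ (∀ x y, τ (x * y) = τ (y * x)) ∧
      ((𝔣 / 8 : ℝ) : ℂ) ≤ τ a ∧ ∀ i, τ (p i i) = 0 := by
  classical
  -- Each `S (F, k)` is weak* compact by Banach–Alaoglu. The bound at `a` is a closed condition and
  -- keeps the limit away from `0`.
  let S : Finset A × ℕ → Set (WeakDual ℂ A) := fun q =>
    (WeakDual.toStrongDual ⁻¹' Metric.closedBall 0 1) ∩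
    ({ω | ∀ x, 0 ≤ ω (star x * x)} ∩ ({ω | ((𝔣 / 8 : ℝ) : ℂ) ≤ ω a} ∩
    ({ω | ∀ i, ‖ω (p i i)‖ ≤ 1 / ((q.2 : ℝ) + 1)} ∩
      {ω | ∀ x ∈ q.1, ∀ y ∈ q.1, ‖ω (x * y) - ω (y * x)‖ ≤ 1 / ((q.2 : ℝ) + 1)})))
  have hev (x : A) : Continuous fun ω : WeakDual ℂ A => ω x := WeakDual.eval_continuous x
  have hclosed (q) : IsClosed (S q) := by
    refine (WeakDual.isClosed_closedBall 0 1).inter (IsClosed.inter ?_ (IsClosed.inter ?_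
      (IsClosed.inter ?_ ?_)))
    · rw [Set.ofPred_forall]
      exact isClosed_iInter fun x => isClosed_le continuous_const (hev _)
    · exact isClosed_le continuous_const (hev _)
    · rw [Set.ofPred_forall]
      exact isClosed_iInter fun i => isClosed_le (hev _).norm continuous_const
    · simp only [Set.ofPred_forall]
      exact isClosed_iInter fun x => isClosed_iInter fun _ => isClosed_iInter fun y =>
        isClosed_iInter fun _ => isClosed_le ((hev _).sub (hev _)).norm continuous_const
  have hne (q) : (S q).Nonempty := by
    obtain ⟨F, k⟩ := q
    have hk : (0 : ℝ) < 1 / ((k : ℝ) + 1) := by positivity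
    have hk1 : 1 / ((k : ℝ) + 1) ≤ 1 := by
      rw [div_le_one (by positivity)]
      linarith [(Nat.cast_nonneg k : (0 : ℝ) ≤ k)]
    -- With this `c`, both `2 * n ^ 3 * ε` and `2 * ε` are at most `1 / (k + 1)`, and `n ^ 3 * ε < 1
    -- / 4`.
    let c : ℝ := 8 * (n * (n * n)) + 8
    have hc : 0 < c := by positivity
    let ε : ℝ := 1 / ((k : ℝ) + 1) / c
    have hε : 0 < ε := by positivity
    have hεc : ε * c = 1 / ((k : ℝ) + 1) := div_mul_cancel₀ _ hc.ne'
    have hn : 8 * (n * (n * (n * ε))) + 8 * ε = 1 / ((k : ℝ) + 1) := by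
      rw [← hεc]; simp only [c]; ring
    have hn0 : 0 ≤ n * (n * (n * ε)) := by positivity
    obtain ⟨ω, h1, h2, h3, h4, h5⟩ := (h ε hε
      (F ∪ Finset.univ.image fun ij : Fin n × Fin n => p ij.1 ij.2)).exists_functional ha hp
      (fun i j => Finset.mem_union_right _
        (Finset.mem_image_of_mem (fun ij : Fin n × Fin n => p ij.1 ij.2)
          (Finset.mem_univ (i, j)))) (by linarith)
    refine ⟨StrongDual.toWeakDual ω, ?_, h2, h3, fun i => (h4 i).trans (by linarith),
      fun x hx y hy => (h5 x (Finset.mem_union_left _ hx) y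
        (Finset.mem_union_left _ hy)).trans (by linarith)⟩
    exact mem_closedBall_zero_iff.2 h1
  have hanti {q r : Finset A × ℕ} (h1 : q.1 ⊆ r.1) (h2 : q.2 ≤ r.2) : S r ⊆ S q := by
    rintro ω ⟨s1, s2, s3, s4, s5⟩
    have h3 : 1 / ((r.2 : ℝ) + 1) ≤ 1 / ((q.2 : ℝ) + 1) := by gcongr
    exact ⟨s1, s2, s3, fun i => (s4 i).trans h3,
      fun x hx y hy => (s5 x (h1 hx) y (h1 hy)).trans h3⟩
  have hdir : Directed (· ⊇ ·) S := fun q r =>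
    ⟨(q.1 ∪ r.1, max q.2 r.2), hanti Finset.subset_union_left (le_max_left _ _),
      hanti Finset.subset_union_right (le_max_right _ _)⟩
  obtain ⟨τ, hτ⟩ := IsCompact.nonempty_iInter_of_directed_nonempty_isCompact_isClosed S hdir hne
    (fun q => (WeakDual.isCompact_closedBall 0 1).of_isClosed_subset (hclosed q)
      Set.inter_subset_left) hclosed
  rw [Set.mem_iInter] at hτ
  have hzero {z : ℂ} (hz : ∀ k : ℕ, ‖z‖ ≤ 1 / ((k : ℝ) + 1)) : z = 0 :=
    norm_le_zero_iff.1 (ge_of_tendsto' tendsto_one_div_add_atTop_nhds_zero_nat hz)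
  refine ⟨WeakDual.toStrongDual τ, (hτ (∅, 0)).2.1, fun x y => ?_, (hτ (∅, 0)).2.2.1,
    fun i => hzero fun k => (hτ (∅, k)).2.2.2.1 i⟩
  exact sub_eq_zero.1 (hzero fun k => (hτ ({x, y}, k)).2.2.2.2 x (by simp) y (by simp))

end ClassD

end GenTracialRank

end

theorem mainTheorem5 {A : Type*} [NonUnitalCStarAlgebra A] [PartialOrder A] [StarOrderedRing A]
    (hA : GenTracialRank.ClassD A) : GenTracialRank.StablyProjectionless A := by
  obtain ⟨hs, a, ⟨ha, -⟩, ha1, 𝔣, hf, -, h⟩ := hA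
  intro n p hp
  have ha0 : a ≠ 0 := norm_ne_zero_iff.1 (by rw [ha1]; exact one_ne_zero)
  obtain ⟨τ, hpos, htr, hτa, hτp⟩ :=
    GenTracialRank.exists_trace_of_hasTracialApprox ha (fun ε hε F => h ε hε F a ha ha0) hp
  -- Faithfulness of `τ` needs a product on which `τ` is non-zero; `a = star s * s` supplies it.
  obtain ⟨s, rfl⟩ := CStarAlgebra.nonneg_iff_eq_star_mul_self.1 ha
  have hne : τ (star s * s) ≠ 0 := by
    intro h0
    rw [h0] at hτa
    have : 𝔣 / 8 ≤ 0 := by simpa using (Complex.le_def.1 hτa).1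
    linarith
  have hp' : IsStarProjection (show Matrix (Fin n) (Fin n) A from p) := ⟨hp.1, hp.2⟩
  refine CStarMatrix.ext fun j i => hs.eq_zero_of_trace_eq_zero hpos htr hne ?_
  -- For a projection, column `i` satisfies `∑ k, star (p k i) * p k i = p i i`, so `τ (p i i) = 0`
  -- kills the whole column.
  have h1 : ∑ k, τ (star (p k i) * p k i) = 0 := by
    rw [← map_sum, ← GenTracialRank.isStarProjection_apply_self hp' i]
    exact hτp i
  exact (Finset.sum_eq_zero_iff_of_nonneg fun k _ => hpos (p k i)).1 h1 j (Finset.mem_univ _)
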